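/- Let $m\ge 1$, let $\Sigma=\{\alpha_1,\dots,\alpha_m,\beta_1,\dots,\beta_m\}$, and let $M$ be the monoid with zero generated by $\Sigma$ subject to the relations $\alpha_j\beta_j=1$ for all $j$ and $\alpha_i\beta_j=0$ for $i\ne j$. The two-sided $m$-Dyck shift $X\subset\Sigma^{\mathbb Z}$ is the set of all $x$ such that no finite block $x_r x_{r+1}\cdots x_l$ of $x$ equals $0$ in $M$. Its double-tail relation is $$\mathcal T_2(X)=\{(x,x')\in X\times X:\ \exists n\ge 0\ \forall |k|>n\ \ x_k=x'_k\}.$$ A $\mathcal T_2(X)$-holonomy is an injective Borel map $g:A\to g(A)$ with $A\subset X$ Borel and $(x,g(x))\in\mathcal T_2(X)$ for every $x\in A$; a Borel probability measure $\mu$ on $X$ is $\mathcal T_2$-invariant (double-tail invariant) if $\mu(A)=\mu(g(A))$ for every $\mathcal T_2(X)$-holonomy $g:A\to g(A)$. For $z\in\{0,1\}^{\mathbb Z}$ let $\tilde H_0(z)=0$ and $\tilde H_{i+1}(z)-\tilde H_i(z)=1$ if $z_i=1$, $=-1$ if $z_i=0$ $(i\in\mathbb Z)$, and let $$S=\Big\{z\in\{0,1\}^{\mathbb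 Z}:\ \inf_{n\ge 0}\tilde H_n(z)=-\infty,\ \inf_{n<0}\tilde H_n(z)=-\infty\Big\}.$$ For $k\ge 0$ put $\gamma_k(z)=\sum_{i=0}^{k}z_i$, for $k<0$ put $\gamma_k(z)=-\sum_{i=k}^{-1}z_i$, and for $z\in S$ put $\varepsilon_n(z)=\max\{l<n:\ \tilde H_l(z)\le\tilde H_{n+1}(z)\}$. Define $F:S\times\{1,\dots,m\}^{\mathbb Z}\to\Sigma^{\mathbb Z}$ by $$F(z,a)_n=\begin{cases}\alpha_j,\quad j=a_{\gamma_n(z)}, & \text{if } z_n=1,\\ \beta_j,\quad j=a_{\gamma_k(z)},\ k=\varepsilon_n(z), & \text{if } z_n=0.\end{cases}$$ Let $\mu_1$ be the symmetric Bernoulli measure on $\{0,1\}^{\mathbb Z}$ (the product of the measures $(\tfrac12,\tfrac12)$), let $\mu_2$ be the uniform product measure on $\{1,\dots,m\}^{\mathbb Z}$, and let $\tilde\mu=(\mu_1\times\mu_2)\circ F^{-1}$. Then $\tilde\mu$ is a probability measure on the two-sided Dyck shift $X$ (that is, it is a probability measure with $\tilde\mu(\Sigma^{\mathbb Z}\setminus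 X)=0$), and it is $\mathcal T_2$-invariant. -/

import Mathlib

open MeasureTheory

namespace DyckShift

noncomputable section

/-! ### The double-tail relation of a two-sided subshift -/

/-- The double-tail (homoclinic) relation of `X ⊆ S^ℤ`: both points lie in `X` and they agree
at all coordinates `k` with `|k| > n`, for some `n ≥ 0`. -/
def DoubleTail {S : Type*} (X : Set (ℤ → S)) (x x' : ℤ → S) : Prop :=
  x ∈ X ∧ x' ∈ X ∧ ∃ n : ℕ, ∀ k : ℤ, (n : ℤ) < |k| → x k = x' k

/-- A double-tail holonomy of `X`: an injective Borel map `g`, defined on a Borel set `A`,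
with `(x, g x)` in the double-tail relation of `X` for every `x ∈ A` (so `A ⊆ X`). -/
structure IsHolonomy {S : Type*} [MeasurableSpace S] (X : Set (ℤ → S)) (A : Set (ℤ → S))
    (g : A → (ℤ → S)) : Prop where
  measurableSet_dom : MeasurableSet A
  measurable : Measurable g
  injective : Function.Injective g
  doubleTail : ∀ x : A, DoubleTail X x (g x)

/-- `μ` is double-tail invariant for `X`: `μ(A) = μ(g(A))` for every double-tail holonomy `g`
of `X` with domain `A`. -/
def IsDoubleTailInvariant {S : Type*} [MeasurableSpace S] (X : Set (ℤ → S))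
    (μ : Measure (ℤ → S)) : Prop :=
  ∀ (A : Set (ℤ → S)) (g : A → (ℤ → S)), IsHolonomy X A g → μ A = μ (Set.range g)

/-! ### The two-sided `m`-Dyck shift -/

/-- The alphabet `{α_j} ∪ {β_j}`, `j` ranging over `m` bracket types. -/
inductive Letter (m : ℕ) : Type
  | α (j : Fin m) : Letter m
  | β (j : Fin m) : Letter m

/-- The alphabet is discrete; `ℤ → Letter m` carries the product (= Borel) σ-algebra. -/
instance (m : ℕ) : MeasurableSpace (Letter m) := ⊤

/-- A letter, in the free monoid with zero on the alphabet. -/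
def Letter.toFree {m : ℕ} (s : Letter m) : WithZero (FreeMonoid (Letter m)) :=
  ((FreeMonoid.of s : FreeMonoid (Letter m)) : WithZero (FreeMonoid (Letter m)))

/-- The defining relations of the syntactic monoid: `α_j β_j = 1`, and `α_i β_j = 0` for
`i ≠ j`. -/
inductive DyckRel (m : ℕ) :
    WithZero (FreeMonoid (Letter m)) → WithZero (FreeMonoid (Letter m)) → Prop
  | matched (j : Fin m) : DyckRel m ((Letter.α j).toFree * (Letter.β j).toFree) 1
  | mismatched (i j : Fin m) (h : i ≠ j) :
      DyckRel m ((Letter.α i).toFree * (Letter.β j).toFree) 0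

/-- The congruence `≡ (mod M)`, where `M` is the monoid with zero generated by the alphabet,
subject to the relations `DyckRel`. -/
def dyckCon (m : ℕ) : Con (WithZero (FreeMonoid (Letter m))) := conGen (DyckRel m)

/-- The `m`-Dyck language: the finite words which are not `0` modulo `M`. -/
def dyckLanguage (m : ℕ) : Set (List (Letter m)) :=
  {l | ¬ dyckCon m
    ((FreeMonoid.ofList l : FreeMonoid (Letter m)) : WithZero (FreeMonoid (Letter m))) 0}

/-- The block of `x` occupying the `n` coordinates `r, r + 1, …, r + n - 1`. -/
def block {S : Type*} (x : ℤ → S) (r : ℤ) (n : ℕ) : List S :=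
  List.ofFn fun i : Fin n => x (r + (i : ℕ))

/-- The two-sided `m`-Dyck shift: all finite blocks lie in the `m`-Dyck language. -/
def dyckShift (m : ℕ) : Set (ℤ → Letter m) :=
  {x | ∀ (r : ℤ) (n : ℕ), block x r n ∈ dyckLanguage m}

/-! ### The bracket-typing map and the measure -/

/-- The height `H_i(z)` of a `0`-`1` sequence: `0` at `i = 0`, going up by one over each `1` and
down by one over each `0`. -/
def height (z : ℤ → Fin 2) (i : ℤ) : ℤ :=
  if 0 ≤ i then
    ∑ j ∈ Finset.Ico 0 i, ((if z j = 1 then 1 else 0) - (if z j = 0 then 1 else 0))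
  else
    ∑ j ∈ Finset.Ico i 0, ((if z j = 0 then 1 else 0) - (if z j = 1 then 1 else 0))

/-- The set of `z` with `inf_{n ≥ 0} H_n(z) = -∞` and `inf_{n < 0} H_n(z) = -∞`. -/
def recurrentSet : Set (ℤ → Fin 2) :=
  {z | (∀ c : ℤ, ∃ n : ℤ, 0 ≤ n ∧ height z n < c) ∧ (∀ c : ℤ, ∃ n : ℤ, n < 0 ∧ height z n < c)}

/-- The numbering `γ_k(z)` of the positions `k` of the ones of `z`. -/
def oneIndex (z : ℤ → Fin 2) (k : ℤ) : ℤ :=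
  if 0 ≤ k then ∑ i ∈ Finset.Icc 0 k, ((z i : ℕ) : ℤ)
  else -∑ i ∈ Finset.Icc k (-1), ((z i : ℕ) : ℤ)

/-- `ε_n(z) = max {l < n : H_l(z) ≤ H_{n+1}(z)}`. For `z ∈ recurrentSet` this set of integers is
nonempty and bounded above, so the supremum is its maximum. -/
def matchIndex (z : ℤ → Fin 2) (n : ℤ) : ℤ :=
  sSup {l : ℤ | l < n ∧ height z l ≤ height z (n + 1)}

/-- The bracket-typing map `F`; only its values at `z ∈ recurrentSet` matter. -/
def bracketTyping (m : ℕ) (p : (ℤ → Fin 2) × (ℤ → Fin m)) : ℤ → Letter m := fun n =>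
  if p.1 n = 1 then Letter.α (p.2 (oneIndex p.1 n))
  else Letter.β (p.2 (oneIndex p.1 (matchIndex p.1 n)))

/-- The symmetric product measure on `{1, …, k}^ℤ` (here `Fin k` in place of `{1, …, k}`, and
`Fin 2 = {0, 1}` when `k = 2`): independent uniformly distributed coordinates. -/
def uniformProduct (k : ℕ) [NeZero k] : Measure (ℤ → Fin k) :=
  Measure.infinitePi fun _ : ℤ => (PMF.uniformOfFintype (Fin k)).toMeasure

/-- `μ̃ = (μ₁ × μ₂) ∘ F⁻¹`, where the domain of `F` is `recurrentSet × {1, …, m}^ℤ`. -/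
def bracketMeasure (m : ℕ) [NeZero m] : Measure (ℤ → Letter m) :=
  (((uniformProduct 2).prod (uniformProduct m)).restrict (recurrentSet ×ˢ Set.univ)).map
    (bracketTyping m)

end

end DyckShift

namespace DyckShift

noncomputable section

section

/-! ### Heights -/

/-! Given a recurrent pattern `z`, distinct opening brackets read distinct coordinates of `a`, so
their types are independent and uniform. The types may therefore be carried by positions instead of
by `oneIndex` (`bracketMeasure_apply`), which keeps them in place when the pattern is altered. The
pattern is a.s. recurrent because a simple random walk is a.s. unbounded below in both directions.
The typed sequence then lies in the Dyck shift, since each block acts nontrivially on the stack of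
open types (`typing_mem_dyckShift`). Conversely, a point of the shift with recurrent pattern is
determined by its directions and opening types (`typing_dir_type`).

For invariance, cut the domain of a holonomy into countably many pieces on which it replaces a fixed
block `u` on `[-N, N]` by a fixed block `v`. A piece has measure `2^-(2N+1) * m^-(opening brackets
in u)` times the measure of the set of admissible surroundings. Its image has the same form with
`v`, and the same surroundings. If `u` and `v` have equally many opening brackets, or if `m = 1`,
the weights agree. Otherwise the net heights differ by some `d ≠ 0`, so closing brackets far to the
right are matched left of the block at levels shifted by `d`. Legality before and after the exchange
makes the types constant along an infinite progression of levels, so the surroundings form a null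
set (`prod_spliceSet_eq_zero`). -/

lemma eq_zero_of_ne_one {a : Fin 2} (h : a ≠ 1) : a = 0 := by omega

lemma height_zero (z : ℤ → Fin 2) : height z 0 = 0 := by simp [height]

lemma height_add_one (z : ℤ → Fin 2) (i : ℤ) :
    height z (i + 1) = height z i + if z i = 1 then 1 else -1 := by
  rcases le_or_gt 0 i with hi | hi
  · have h : Finset.Ico 0 (i + 1) = insert i (Finset.Ico 0 i) := by ext; simp; omega
    rw [height, height, if_pos (by omega), if_pos hi, h, Finset.sum_insert (by simp), add_comm]
    by_cases hz : z i = 1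
    · simp [hz]
    · simp [eq_zero_of_ne_one hz]
  · have h : Finset.Ico i 0 = insert i (Finset.Ico (i + 1) 0) := by ext; simp; omega
    rw [height, height, if_neg (by omega : ¬ 0 ≤ i)]
    by_cases h0 : 0 ≤ i + 1
    · obtain rfl : i = -1 := by omega
      rw [show Finset.Ico (-1 : ℤ) 0 = {-1} from rfl, Finset.sum_singleton]
      by_cases hz : z (-1) = 1
      · simp [hz]
      · simp [eq_zero_of_ne_one hz]
    · rw [if_neg h0, h, Finset.sum_insert (by simp)]
      by_cases hz : z i = 1
      · simp [hz]
      · simp [eq_zero_of_ne_one hz]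

lemma height_add_one_of_one {z : ℤ → Fin 2} {i : ℤ} (h : z i = 1) :
    height z (i + 1) = height z i + 1 := by
  rw [height_add_one, if_pos h]

lemma height_add_one_of_ne {z : ℤ → Fin 2} {i : ℤ} (h : z i ≠ 1) :
    height z (i + 1) = height z i - 1 := by
  rw [height_add_one, if_neg h, sub_eq_add_neg]

lemma height_le_add_one (z : ℤ → Fin 2) (i : ℤ) : height z i ≤ height z (i + 1) + 1 := by
  rw [height_add_one]; split_ifs <;> omega

lemma height_add_one_le (z : ℤ → Fin 2) (i : ℤ) : height z (i + 1) ≤ height z i + 1 := by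
  rw [height_add_one]; split_ifs <;> omega

lemma neg_abs_le_height (z : ℤ → Fin 2) (i : ℤ) : -|i| ≤ height z i := by
  induction i using Int.induction_on with
  | zero => simp [height_zero]
  | succ i ih =>
    have := height_le_add_one z i
    rw [abs_of_nonneg (by omega)] at *; omega
  | pred i ih =>
    have := height_add_one_le z (-i - 1)
    rw [sub_add_cancel] at this
    rw [abs_of_nonpos (by omega)] at *; omega

/-- A height below `-|N|` occurs only at distance more than `|N|` from the origin, so low points can
be found arbitrarily far out on each side. In this form the origin plays no role. -/
lemma mem_recurrentSet_iff {z : ℤ → Fin 2} : z ∈ recurrentSet ↔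
    (∀ c N : ℤ, ∃ n, N < n ∧ height z n < c) ∧ ∀ c N : ℤ, ∃ n, n < N ∧ height z n < c := by
  constructor
  · rintro ⟨h1, h2⟩
    refine ⟨fun c N => ?_, fun c N => ?_⟩
    · obtain ⟨n, hn, h⟩ := h1 (min c (-|N|))
      refine ⟨n, ?_, by omega⟩
      have := neg_abs_le_height z n
      rw [abs_of_nonneg hn] at this
      have := le_abs_self N
      omega
    · obtain ⟨n, hn, h⟩ := h2 (min c (-|N|))
      refine ⟨n, ?_, by omega⟩
      have := neg_abs_le_height z n
      rw [abs_of_neg hn] at this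
      have := neg_abs_le N
      omega
  · rintro ⟨h1, h2⟩
    refine ⟨fun c => ?_, fun c => h2 c 0⟩
    obtain ⟨n, hn, h⟩ := h1 c 0
    exact ⟨n, hn.le, h⟩

lemma exists_lt_height_le {z : ℤ → Fin 2} (hz : z ∈ recurrentSet) (n h : ℤ) :
    ∃ l, l < n ∧ height z l ≤ h := by
  obtain ⟨l, hl, hh⟩ := (mem_recurrentSet_iff.1 hz).2 (h + 1) n
  exact ⟨l, hl, by omega⟩

/-- The last position before `n` at which the height is at most `h`. -/
def lastBelow (z : ℤ → Fin 2) (n h : ℤ) : ℤ := sSup {l : ℤ | l < n ∧ height z l ≤ h}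

lemma matchIndex_eq (z : ℤ → Fin 2) (n : ℤ) :
    matchIndex z n = lastBelow z n (height z (n + 1)) := rfl

lemma lastBelow_eq {z : ℤ → Fin 2} {n h l : ℤ} (h1 : l < n) (h2 : height z l ≤ h)
    (h3 : ∀ k, l < k → k < n → h < height z k) : lastBelow z n h = l := by
  refine IsGreatest.csSup_eq ⟨⟨h1, h2⟩, ?_⟩
  rintro k ⟨hk1, hk2⟩
  by_contra! hk
  have := h3 k hk hk1
  omega

lemma lastBelow_spec {z : ℤ → Fin 2} (hz : z ∈ recurrentSet) (n h : ℤ) :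
    lastBelow z n h < n ∧ height z (lastBelow z n h) ≤ h ∧
      ∀ k, lastBelow z n h < k → k < n → h < height z k := by
  obtain ⟨l, ⟨hl1, hl2⟩, hl⟩ := Int.exists_greatest_of_bdd
    (P := fun l => l < n ∧ height z l ≤ h) ⟨n, fun k hk => hk.1.le⟩ (exists_lt_height_le hz n h)
  have h3 : ∀ k, l < k → k < n → h < height z k := fun k hk hkn => by
    by_contra! hc
    have := hl k ⟨hkn, hc⟩
    omega
  rw [lastBelow_eq hl1 hl2 h3]
  exact ⟨hl1, hl2, h3⟩

/-- Heights move by unit steps, so the last visit to `h` or lower before a point above `h` is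
exactly at `h` and is followed by an up-step. -/
lemma lastBelow_spec_of_lt {z : ℤ → Fin 2} (hz : z ∈ recurrentSet) {n h : ℤ}
    (hn : h < height z n) : height z (lastBelow z n h) = h ∧ z (lastBelow z n h) = 1 := by
  obtain ⟨h1, h2, h3⟩ := lastBelow_spec hz n h
  have h4 : h < height z (lastBelow z n h + 1) := by
    rcases eq_or_lt_of_le (show lastBelow z n h + 1 ≤ n from h1) with h5 | h5
    · rwa [h5]
    · exact h3 _ (by omega) h5
  have h6 := height_add_one z (lastBelow z n h)
  split_ifs at h6 with h7
  · exact ⟨by omega, h7⟩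
  · omega

lemma lastBelow_add_one {z : ℤ → Fin 2} (hz : z ∈ recurrentSet) (n h : ℤ) :
    lastBelow z (n + 1) h = if height z n ≤ h then n else lastBelow z n h := by
  split_ifs with hn
  · exact lastBelow_eq (by omega) hn fun k hk hk' => by omega
  · obtain ⟨h1, h2, h3⟩ := lastBelow_spec hz n h
    refine lastBelow_eq (by omega) h2 fun k hk hk' => ?_
    rcases eq_or_lt_of_le (show k ≤ n by omega) with rfl | h4
    · omega
    · exact h3 k hk h4

lemma matchIndex_spec {z : ℤ → Fin 2} (hz : z ∈ recurrentSet) {n : ℤ} (hn : z n ≠ 1) :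
    matchIndex z n < n ∧ height z (matchIndex z n) = height z (n + 1) ∧ z (matchIndex z n) = 1 ∧
      ∀ k, matchIndex z n < k → k ≤ n → height z (n + 1) < height z k := by
  have h := height_add_one_of_ne hn
  obtain ⟨h1, h2, h3⟩ := lastBelow_spec hz n (height z (n + 1))
  obtain ⟨h4, h5⟩ := lastBelow_spec_of_lt hz (show height z (n + 1) < height z n by omega)
  refine ⟨h1, h4, h5, fun k hk hk' => ?_⟩
  rcases eq_or_lt_of_le hk' with rfl | h6
  · omega
  · exact h3 k hk h6

/-! ### Typed sequences -/

variable {m : ℕ}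

/-- The bracket sequence with up-down pattern `z` in which the opening bracket at `n` has type
`b n` and each closing bracket has the type of its match. -/
def typing (z : ℤ → Fin 2) (b : ℤ → Fin m) : ℤ → Letter m := fun n =>
  if z n = 1 then Letter.α (b n) else Letter.β (b (matchIndex z n))

lemma typing_congr {z : ℤ → Fin 2} (hz : z ∈ recurrentSet) {b b' : ℤ → Fin m}
    (h : ∀ n, z n = 1 → b n = b' n) : typing z b = typing z b' := by
  funext n
  by_cases hn : z n = 1
  · simp [typing, hn, h n hn]
  · simp [typing, hn, h _ (matchIndex_spec hz hn).2.2.1]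

/-- The direction of a bracket: `1` for opening and `0` for closing brackets. -/
def Letter.dir : Letter m → Fin 2
  | Letter.α _ => 1
  | Letter.β _ => 0

/-- The type of a bracket. -/
def Letter.type : Letter m → Fin m
  | Letter.α j => j
  | Letter.β j => j

lemma dir_typing (z : ℤ → Fin 2) (b : ℤ → Fin m) (n : ℤ) : (typing z b n).dir = z n := by
  by_cases hn : z n = 1
  · simp [typing, hn, Letter.dir]
  · simp [typing, Letter.dir, eq_zero_of_ne_one hn]

lemma type_typing {z : ℤ → Fin 2} {b : ℤ → Fin m} {n : ℤ} (h : z n = 1) :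
    (typing z b n).type = b n := by
  simp [typing, h, Letter.type]

/-! ### Nonzero words -/

/-- The infinite stack of types of the brackets still open before position `n`. -/
def stack (z : ℤ → Fin 2) (b : ℤ → Fin m) (n : ℤ) : ℕ → Fin m := fun k =>
  b (lastBelow z n (height z n - 1 - k))

/-- Pushing a type on a stack. -/
def push (j : Fin m) (s : ℕ → Fin m) : ℕ → Fin m
  | 0 => j
  | k + 1 => s k

/-- The action of the brackets on functions of infinite stacks. -/
def letterEnd : Letter m → AddMonoid.End ((ℕ → Fin m) → ℤ)
  | Letter.α j =>
    { toFun := fun f s => f (push j s)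
      map_zero' := rfl
      map_add' := fun _ _ => rfl }
  | Letter.β j =>
    { toFun := fun f s => if s 0 = j then f (fun k => s (k + 1)) else 0
      map_zero' := by funext s; simp
      map_add' := fun f g => by funext s; simp only [Pi.add_apply]; split_ifs <;> simp }

lemma letterEnd_α_apply (j : Fin m) (f : (ℕ → Fin m) → ℤ) (s : ℕ → Fin m) :
    letterEnd (Letter.α j) f s = f (push j s) := rfl

lemma letterEnd_β_apply (j : Fin m) (f : (ℕ → Fin m) → ℤ) (s : ℕ → Fin m) :
    letterEnd (Letter.β j) f s = if s 0 = j then f (fun k => s (k + 1)) else 0 := rfl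

/-- The extension of the action of brackets on stacks to the free monoid with zero. -/
def wordEnd (m : ℕ) :
    WithZero (FreeMonoid (Letter m)) →*₀ AddMonoid.End ((ℕ → Fin m) → ℤ) :=
  WithZero.lift' (FreeMonoid.lift letterEnd)

lemma wordEnd_toFree (s : Letter m) : wordEnd m s.toFree = letterEnd s := by
  simp [wordEnd, Letter.toFree]

lemma wordEnd_ofList (l : List (Letter m)) :
    wordEnd m ((FreeMonoid.ofList l : FreeMonoid (Letter m)) : WithZero (FreeMonoid (Letter m))) =
      (l.map letterEnd).prod := by
  simp [wordEnd, FreeMonoid.lift_apply]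

/-- Acting on functions of stacks makes a product read its word from left to right: `α` pushes, and
`β` pops or gives zero on a mismatch. -/
lemma dyckCon_le_ker : dyckCon m ≤ Con.ker (wordEnd m) := by
  rw [dyckCon, Con.conGen_le]
  rintro _ _ (j | ⟨i, j, h⟩)
  · change wordEnd m _ = wordEnd m _
    rw [map_mul, wordEnd_toFree, wordEnd_toFree, map_one]
    ext f s
    rw [AddMonoid.End.coe_mul, Function.comp_apply]
    simp [letterEnd_α_apply, letterEnd_β_apply, push]
  · change wordEnd m _ = wordEnd m _
    rw [map_mul, wordEnd_toFree, wordEnd_toFree, map_zero]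
    ext f s
    rw [AddMonoid.End.coe_mul, Function.comp_apply]
    simp [letterEnd_α_apply, letterEnd_β_apply, push, h]

lemma mem_dyckLanguage_of_prod_ne_zero {l : List (Letter m)}
    (h : (l.map letterEnd).prod ≠ 0) : l ∈ dyckLanguage m := fun h0 => by
  have := dyckCon_le_ker h0
  change wordEnd m _ = wordEnd m _ at this
  rw [wordEnd_ofList, map_zero] at this
  exact h this

lemma stack_of_one {z : ℤ → Fin 2} (hz : z ∈ recurrentSet) (b : ℤ → Fin m) {n : ℤ}
    (hn : z n = 1) : stack z b (n + 1) = push (b n) (stack z b n) := by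
  funext k
  have h := height_add_one_of_one hn
  cases k with
  | zero => rw [stack, lastBelow_add_one hz, if_pos (by simp [h]), push]
  | succ k =>
    rw [stack, lastBelow_add_one hz, if_neg (by push_cast; omega), push, stack, h]
    congr 2
    push_cast; ring

lemma stack_of_ne {z : ℤ → Fin 2} (hz : z ∈ recurrentSet) (b : ℤ → Fin m) {n : ℤ}
    (hn : z n ≠ 1) : stack z b (n + 1) = fun k => stack z b n (k + 1) := by
  funext k
  have h := height_add_one_of_ne hn
  rw [stack, lastBelow_add_one hz, if_neg (by omega), stack, h]
  congr 2
  push_cast; ring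

/-- At a closing bracket the top of the stack is the type of its match, so the pop never fails. -/
lemma letterEnd_typing_apply {z : ℤ → Fin 2} (hz : z ∈ recurrentSet) (b : ℤ → Fin m) (n : ℤ)
    (f : (ℕ → Fin m) → ℤ) :
    letterEnd (typing z b n) f (stack z b n) = f (stack z b (n + 1)) := by
  by_cases hn : z n = 1
  · simp [typing, hn, letterEnd_α_apply, stack_of_one hz b hn]
  · have h : stack z b n 0 = b (matchIndex z n) := by
      simp [stack, matchIndex_eq, height_add_one_of_ne hn]
    simp [typing, hn, letterEnd_β_apply, stack_of_ne hz b hn, h]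

lemma block_succ {S : Type*} (x : ℤ → S) (r : ℤ) (n : ℕ) :
    block x r (n + 1) = x r :: block x (r + 1) n := by
  simp [block, List.ofFn_succ, add_comm, add_left_comm]

lemma block_succ' {S : Type*} (x : ℤ → S) (r : ℤ) (n : ℕ) :
    block x r (n + 1) = block x r n ++ [x (r + n)] := by
  rw [block, List.ofFn_succ']
  simp [block, List.concat_eq_append]

lemma prod_block_typing_apply {z : ℤ → Fin 2} (hz : z ∈ recurrentSet) (b : ℤ → Fin m) (n : ℕ)
    (r : ℤ) (f : (ℕ → Fin m) → ℤ) :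
    ((block (typing z b) r n).map letterEnd).prod f (stack z b r) = f (stack z b (r + n)) := by
  induction n generalizing r with
  | zero => simp [block]
  | succ n ih =>
    rw [block_succ, List.map_cons, List.prod_cons, AddMonoid.End.coe_mul, Function.comp_apply,
      letterEnd_typing_apply hz, ih]
    congr 2
    push_cast; ring

theorem typing_mem_dyckShift {z : ℤ → Fin 2} (hz : z ∈ recurrentSet) (b : ℤ → Fin m) :
    typing z b ∈ dyckShift m := fun r n => by
  refine mem_dyckLanguage_of_prod_ne_zero fun h => ?_
  -- The constant test function keeps the value 1 at the stack, so the product cannot vanish.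
  have := prod_block_typing_apply hz b n r (fun _ => 1)
  rw [h] at this
  simp at this

/-! ### Points of the Dyck shift are determined by their opening brackets -/

/-- The class of a word in the monoid with zero presented by the relations `DyckRel`. -/
def wordClass (l : List (Letter m)) : (dyckCon m).Quotient :=
  (dyckCon m).mk' ((FreeMonoid.ofList l : FreeMonoid (Letter m)) :
    WithZero (FreeMonoid (Letter m)))

/-- The class of zero in the monoid with zero presented by the relations `DyckRel`. -/
def zeroClass (m : ℕ) : (dyckCon m).Quotient := (dyckCon m).mk' 0

lemma wordClass_append (l l' : List (Letter m)) :
    wordClass (l ++ l') = wordClass l * wordClass l' := by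
  simp [wordClass, FreeMonoid.ofList_append, WithZero.coe_mul]

lemma zeroClass_mul (a : (dyckCon m).Quotient) : zeroClass m * a = zeroClass m := by
  obtain ⟨w, rfl⟩ := Con.mk'_surjective a
  rw [zeroClass, ← map_mul, zero_mul]

lemma mul_zeroClass (a : (dyckCon m).Quotient) : a * zeroClass m = zeroClass m := by
  obtain ⟨w, rfl⟩ := Con.mk'_surjective a
  rw [zeroClass, ← map_mul, mul_zero]

lemma mem_dyckLanguage_iff {l : List (Letter m)} :
    l ∈ dyckLanguage m ↔ wordClass l ≠ zeroClass m := by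
  rw [Ne, wordClass, zeroClass, Con.coe_mk', Con.eq]; rfl

lemma wordClass_matched (j : Fin m) : wordClass [Letter.α j, Letter.β j] = 1 := by
  rw [← map_one (dyckCon m).mk', wordClass, Con.coe_mk', Con.eq]
  exact Con.le_conGen _ _ (DyckRel.matched j)

lemma wordClass_mismatched {i j : Fin m} (h : i ≠ j) :
    wordClass [Letter.α i, Letter.β j] = zeroClass m := by
  rw [zeroClass, wordClass, Con.coe_mk', Con.eq]
  exact Con.le_conGen _ _ (DyckRel.mismatched i j h)

/-- While the height stays above its value at `l`, the bracket at `l` is not cancelled. A prefix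
either is zero or reduces to opening brackets only, whose number is the height gained. -/
lemma wordClass_prefix {x : ℤ → Letter m} {l n : ℤ} {i : Fin m} (hi : x l = Letter.α i)
    (hl : ∀ k, l < k → k ≤ n → height (fun k => (x k).dir) l < height (fun k => (x k).dir) k)
    (k : ℕ) (hk : l + k < n) :
    wordClass (block x l (k + 1)) = zeroClass m ∨ ∃ q : List (Fin m),
      (q.length : ℤ) + 1 =
        height (fun k => (x k).dir) (l + k + 1) - height (fun k => (x k).dir) l ∧
      wordClass (block x l (k + 1)) = wordClass (Letter.α i :: q.map Letter.α) := by
  induction k with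
  | zero =>
    refine Or.inr ⟨[], ?_, by simp [block, hi]⟩
    have := height_add_one_of_one (z := fun k => (x k).dir) (i := l) (by simp [hi, Letter.dir])
    simp [this]
  | succ k ih =>
    rw [block_succ', wordClass_append]
    rcases ih (by push_cast at hk; omega) with h0 | ⟨q, hq, hw⟩
    · left
      rw [h0, zeroClass_mul]
    · have hp : l + (k + 1 : ℕ) = l + k + 1 := by push_cast; ring
      have hpos := hl (l + k + 1 + 1) (by omega) (by omega)
      rw [hw, hp, ← wordClass_append]
      rcases hx : x (l + k + 1) with j | j
      · right
        refine ⟨q ++ [j], ?_, by simp⟩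
        rw [height_add_one_of_one (by simp [hx, Letter.dir])]
        simp only [List.length_append, List.length_singleton]
        push_cast
        omega
      · rw [height_add_one_of_ne (by simp [hx, Letter.dir])] at hpos ⊢
        -- For empty `q` this closing bracket would bring the height back to its value at `l`,
        -- against `hpos`.
        obtain rfl | ⟨q, j', rfl⟩ := q.eq_nil_or_concat'
        · simp only [List.length_nil] at hq
          omega
        · have : Letter.α i :: (q ++ [j']).map Letter.α ++ [Letter.β j] =
              Letter.α i :: q.map Letter.α ++ [Letter.α j', Letter.β j] := by simp
          rw [this, wordClass_append]
          by_cases hj : j' = j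
          · right
            refine ⟨q, ?_, by rw [hj, wordClass_matched, mul_one]⟩
            simp only [List.length_append, List.length_singleton] at hq
            push_cast at hq
            omega
          · left
            rw [wordClass_mismatched hj, mul_zeroClass]

/-- The block from a match `l` up to just before `n` gains height one, so if nonzero it reduces to
the single bracket at `l`. A closing bracket of another type at `n` would then produce a zero block.
-/
theorem typing_dir_type {x : ℤ → Letter m} (hx : x ∈ dyckShift m)
    (hz : (fun n => (x n).dir) ∈ recurrentSet) :
    typing (fun n => (x n).dir) (fun n => (x n).type) = x := by
  funext n
  rcases hn : x n with j | j
  · simp [typing, hn, Letter.dir, Letter.type]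
  · have hn1 : (x n).dir ≠ 1 := by simp [hn, Letter.dir]
    obtain ⟨h1, h2, h3, h4⟩ := matchIndex_spec hz hn1
    set l := matchIndex (fun n => (x n).dir) n with hl
    rcases hi : x l with i | i
    swap
    · simp [hi, Letter.dir] at h3
    rw [typing, if_neg hn1, ← hl, hi]
    by_contra hij
    have hij : i ≠ j := fun h => hij (by rw [h]; rfl)
    obtain ⟨k, hk⟩ : ∃ k : ℕ, n = l + k + 1 := ⟨(n - l - 1).toNat, by omega⟩
    have hblock := hx l (k + 1 + 1)
    rw [mem_dyckLanguage_iff, block_succ', wordClass_append] at hblock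
    have hp : l + (k + 1 : ℕ) = n := by push_cast; omega
    rcases wordClass_prefix hi (fun k hk hk' => h2 ▸ h4 k hk hk') k (by omega) with
      h0 | ⟨q, hq, hw⟩
    · rw [h0, zeroClass_mul] at hblock
      exact hblock rfl
    · have := height_add_one_of_ne (z := fun n => (x n).dir) hn1
      rw [← hk] at hq
      obtain rfl : q = [] := List.length_eq_zero_iff.1 (by omega)
      rw [hw, ← wordClass_append, hp, hn] at hblock
      exact hblock (wordClass_mismatched hij)

end

/-! ### Almost sure recurrence of the pattern, and measurability -/

section

open ProbabilityTheory Filter Topology in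
/-- A sum of independent centred signs is almost surely unbounded below. -/
theorem ae_exists_sum_lt {Ω : Type*} [MeasurableSpace Ω] {μ : Measure Ω} [IsProbabilityMeasure μ]
    {X : ℕ → Ω → ℝ} (hX : ∀ i, Measurable (X i)) (hind : iIndepFun X μ)
    (habs : ∀ i ω, |X i ω| = 1) (hint : ∀ i, ∫ ω, X i ω ∂μ = 0) :
    ∀ᵐ ω ∂μ, ∀ c : ℝ, ∃ n : ℕ, ∑ i ∈ Finset.range n, X i ω < c := by
  have hsm : ∀ i, StronglyMeasurable (X i) := fun i => (hX i).stronglyMeasurable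
  have hI : ∀ i, Integrable (X i) μ := fun i =>
    Integrable.of_bound (hX i).aestronglyMeasurable 1 (ae_of_all _ fun ω => (habs i ω).le)
  have hadd : ∀ n ω, (∑ i ∈ Finset.range (n + 1 + 1), X i) ω =
      (∑ i ∈ Finset.range (n + 1), X i) ω + X (n + 1) ω := fun n ω => by
    rw [Finset.sum_range_succ]; rfl
  -- Index `n` carries `n + 1` terms, which makes the sums adapted to the natural filtration of `X`.
  have hM : Martingale (fun n => ∑ i ∈ Finset.range (n + 1), X i) (Filtration.natural X hsm) μ := by
    refine martingale_of_condExp_sub_eq_zero_nat (fun n => ?_) (fun n => ?_) fun n => ?_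
    · refine Finset.stronglyMeasurable_sum _ fun i hi => ?_
      exact (Filtration.stronglyAdapted_natural hsm i).mono
        ((Filtration.natural X hsm).mono (by simpa [Nat.lt_succ_iff] using hi))
    · exact integrable_finsetSum' _ fun i _ => hI i
    · have h : ((∑ i ∈ Finset.range (n + 1 + 1), X i) - ∑ i ∈ Finset.range (n + 1), X i)
          = X (n + 1) := by
        rw [Finset.sum_range_succ, add_sub_cancel_left]
      rw [h]
      refine (hind.condExp_natural_ae_eq_of_lt hsm (Nat.lt_succ_self n)).trans (ae_of_all _ ?_)
      intro ω
      exact hint _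
  -- With bounded increments, being bounded above is a.s. equivalent to convergence. A walk bounded
  -- below would thus converge, which increments of modulus one forbid.
  have hb := hM.neg.submartingale.bddAbove_iff_exists_tendsto (R := 1) (ae_of_all _ fun ω i => by
    simp only [Pi.neg_apply, hadd]
    rw [show -((∑ j ∈ Finset.range (i + 1), X j) ω + X (i + 1) ω) -
      -(∑ j ∈ Finset.range (i + 1), X j) ω = -X (i + 1) ω by ring, abs_neg, habs]
    simp)
  filter_upwards [hb] with ω hω c
  by_contra! hc
  obtain ⟨a, ha⟩ := hω.1 ⟨-c, by
    rintro _ ⟨n, rfl⟩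
    have := hc (n + 1)
    simp only [Pi.neg_apply, Finset.sum_apply]
    linarith⟩
  have h1 := (ha.comp (tendsto_add_atTop_nat 1)).sub ha
  rw [sub_self] at h1
  have h2 := h1.abs
  have h3 : ∀ n, |((fun n => (-fun n => ∑ i ∈ Finset.range (n + 1), X i) n ω) ∘ fun a => a + 1) n -
      (-fun n => ∑ i ∈ Finset.range (n + 1), X i) n ω| = 1 := fun n => by
    simp only [Function.comp_apply, Pi.neg_apply, hadd]
    rw [show -((∑ j ∈ Finset.range (n + 1), X j) ω + X (n + 1) ω) -
      -(∑ j ∈ Finset.range (n + 1), X j) ω = -X (n + 1) ω by ring, abs_neg, habs]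
  simp only [h3, abs_zero] at h2
  exact one_ne_zero (tendsto_nhds_unique tendsto_const_nhds h2)

instance (k : ℕ) [NeZero k] : IsProbabilityMeasure (uniformProduct k) := by
  unfold uniformProduct; infer_instance

lemma height_natCast (z : ℤ → Fin 2) (n : ℕ) :
    height z n = ∑ i ∈ Finset.range n, if z i = 1 then 1 else -1 := by
  induction n with
  | zero => simp [height_zero]
  | succ n ih => rw [Nat.cast_succ, height_add_one, Finset.sum_range_succ, ih]

lemma height_neg_natCast (z : ℤ → Fin 2) (n : ℕ) :
    height z (-n) = ∑ i ∈ Finset.range n, -if z (-i - 1) = 1 then 1 else -1 := by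
  induction n with
  | zero => simp [height_zero]
  | succ n ih =>
    have := height_add_one z (-n - 1)
    rw [sub_add_cancel] at this
    rw [Finset.sum_range_succ, ← ih, this, Nat.cast_succ, neg_add', add_neg_cancel_right]

open ProbabilityTheory in
lemma ae_exists_sum_sign_lt {e : ℕ → ℤ} (he : Function.Injective e) {f : Fin 2 → ℝ}
    (hf : ∀ a, |f a| = 1) (hf0 : f 0 + f 1 = 0) :
    ∀ᵐ z ∂uniformProduct 2, ∀ c : ℝ, ∃ n : ℕ, ∑ i ∈ Finset.range n, f (z (e i)) < c := by
  have hfm : Measurable f := measurable_of_countable f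
  refine ae_exists_sum_lt (X := fun i (z : ℤ → Fin 2) => f (z (e i)))
    (fun i => hfm.comp (measurable_pi_apply _)) ?_ (fun i z => hf _) fun i => ?_
  · exact (iIndepFun_infinitePi (X := fun _ : ℤ => f) fun _ => hfm).precomp he
  · have h1 := integral_map (μ := uniformProduct 2) (measurable_pi_apply (e i)).aemeasurable
      (f := f) hfm.aestronglyMeasurable
    rw [← h1, uniformProduct, Measure.infinitePi_map_eval, PMF.integral_eq_sum]
    simp only [Fin.sum_univ_two, PMF.uniformOfFintype_apply, smul_eq_mul]
    rw [← mul_add, hf0, mul_zero]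

theorem ae_mem_recurrentSet : ∀ᵐ z ∂uniformProduct 2, z ∈ recurrentSet := by
  have h1 := ae_exists_sum_sign_lt (e := fun n : ℕ => (n : ℤ)) Nat.cast_injective
    (f := fun a => if a = 1 then 1 else -1) (fun a => by split_ifs <;> simp) (by simp)
  have h2 := ae_exists_sum_sign_lt (e := fun n : ℕ => -(n : ℤ) - 1)
    (fun a b h => by simpa using h)
    (f := fun a => -if a = 1 then 1 else -1) (fun a => by split_ifs <;> simp) (by simp)
  filter_upwards [h1, h2] with z hz1 hz2
  refine ⟨fun c => ?_, fun c => ?_⟩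
  · obtain ⟨n, hn⟩ := hz1 c
    refine ⟨n, by omega, ?_⟩
    rw [height_natCast, ← Int.cast_lt (R := ℝ)]
    push_cast
    exact hn
  -- The cap at 0 excludes `n = 0`, so that the index found is strictly negative.
  · obtain ⟨n, hn⟩ := hz2 (min c 0)
    have h : height z (-n) < min c 0 := by
      rw [height_neg_natCast, ← Int.cast_lt (R := ℝ)]
      push_cast
      exact hn
    refine ⟨-n, ?_, by omega⟩
    rcases Nat.eq_zero_or_pos n with rfl | h0
    · simp [height_zero] at h
    · omega

/-! ### Measurability -/

variable {m : ℕ}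

instance : DiscreteMeasurableSpace (Letter m) := ⟨fun _ => trivial⟩

/-- Brackets are pairs of a direction and a type. -/
def Letter.code (s : Letter m) : Fin 2 × Fin m := (s.dir, s.type)

lemma Letter.code_injective : Function.Injective (Letter.code (m := m)) := by
  rintro (i | i) (j | j) h <;> simp_all [Letter.code, Letter.dir, Letter.type]

instance : Countable (Letter m) := Letter.code_injective.countable

instance : StandardBorelSpace (Letter m) := standardBorelSpace_of_discreteMeasurableSpace

lemma measurable_height (i : ℤ) : Measurable fun z => height z i := by
  have h : ∀ j : ℤ, ∀ a : Fin 2,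
      Measurable fun z : ℤ → Fin 2 => if z j = a then (1 : ℤ) else 0 := fun j a =>
    (measurable_of_countable fun b : Fin 2 => if b = a then (1 : ℤ) else 0).comp
      (measurable_pi_apply j)
  unfold height
  split_ifs
  · exact Finset.measurable_sum _ fun j _ => (h j 1).sub (h j 0)
  · exact Finset.measurable_sum _ fun j _ => (h j 0).sub (h j 1)

lemma measurable_oneIndex (i : ℤ) : Measurable fun z => oneIndex z i := by
  have h : ∀ j : ℤ, Measurable fun z : ℤ → Fin 2 => ((z j : ℕ) : ℤ) := fun j =>
    (measurable_of_countable fun b : Fin 2 => ((b : ℕ) : ℤ)).comp (measurable_pi_apply j)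
  unfold oneIndex
  split_ifs
  · exact Finset.measurable_sum _ fun j _ => h j
  · exact (Finset.measurable_sum _ fun j _ => h j).neg

lemma measurableSet_recurrentSet : MeasurableSet recurrentSet := by
  have h : ∀ c n : ℤ, MeasurableSet {z | height z n < c} := fun c n =>
    measurable_height n measurableSet_Iio
  simp only [recurrentSet, Set.ofPred_and, Set.ofPred_forall, Set.ofPred_exists]
  exact (MeasurableSet.iInter fun c => .iUnion fun n => (MeasurableSet.const _).inter (h c n)).inter
    (MeasurableSet.iInter fun c => .iUnion fun n => (MeasurableSet.const _).inter (h c n))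

/-- On the recurrent set, each value is characterised by countably many height comparisons. The
indicator avoids analysing the supremum elsewhere. -/
lemma measurable_indicator_matchIndex (n : ℤ) :
    Measurable (recurrentSet.indicator fun z => matchIndex z n) := by
  refine measurable_to_countable' fun k => ?_
  have h : ∀ i : ℤ, MeasurableSet {z | height z i ≤ height z (n + 1)} := fun i =>
    measurableSet_le (measurable_height i) (measurable_height _)
  have : (recurrentSet.indicator fun z => matchIndex z n) ⁻¹' {k} =
      (recurrentSet ∩ ({_z | k < n} ∩ ({z | height z k ≤ height z (n + 1)} ∩
        ⋂ l, {z | k < l → l < n → ¬ height z l ≤ height z (n + 1)}))) ∪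
      (recurrentSetᶜ ∩ {_z | (0 : ℤ) = k}) := by
    ext z
    by_cases hz : z ∈ recurrentSet
    · simp only [Set.mem_preimage, Set.indicator_of_mem hz, Set.mem_singleton_iff, Set.mem_union,
        Set.mem_inter_iff, hz, Set.mem_ofPred_eq, Set.mem_iInter, not_le, Set.mem_compl_iff,
        not_true_eq_false, false_and, or_false, true_and, matchIndex_eq]
      constructor
      · rintro rfl
        exact lastBelow_spec hz _ _
      · rintro ⟨h1, h2, h3⟩
        exact lastBelow_eq h1 h2 h3
    · simp [hz]
  rw [this]
  refine (measurableSet_recurrentSet.inter ((MeasurableSet.const _).inter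
    ((h k).inter (.iInter fun l => ?_)))).union
    (measurableSet_recurrentSet.compl.inter (MeasurableSet.const _))
  by_cases h1 : k < l <;> by_cases h2 : l < n <;> simp only [h1, h2, true_imp_iff, false_imp_iff]
  · exact (h l).compl
  all_goals simp

lemma measurable_eval_index {Ω ι S : Type*} [MeasurableSpace Ω] [Countable ι] [MeasurableSpace ι]
    [MeasurableSingletonClass ι] [MeasurableSpace S]
    {b : Ω → ι → S} {k : Ω → ι} (hb : Measurable b) (hk : Measurable k) :
    Measurable fun ω => b ω (k ω) := by
  intro s hs
  have : (fun ω => b ω (k ω)) ⁻¹' s = ⋃ i, k ⁻¹' {i} ∩ (fun ω => b ω i) ⁻¹' s := by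
    ext ω; simp
  rw [this]
  exact .iUnion fun i => (hk (measurableSet_singleton i)).inter
    ((measurable_pi_apply i).comp hb hs)

end

section

open scoped ENNReal

/-! ### Product measures -/

section InfinitePi

variable {ι κ S : Type*} [MeasurableSpace S] (μ : Measure S) [IsProbabilityMeasure μ]

lemma infinitePi_map_comp {e : κ → ι} (he : Function.Injective e) :
    (Measure.infinitePi fun _ : ι => μ).map (fun a j => a (e j)) =
      Measure.infinitePi fun _ : κ => μ := by
  classical
  refine Measure.eq_infinitePi _ fun s t ht => ?_
  have hm : Measurable fun (a : ι → S) (j : κ) => a (e j) :=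
    measurable_pi_lambda _ fun j => measurable_pi_apply _
  rw [Measure.map_apply hm (.pi s.countable_toSet fun i _ => ht i)]
  -- Intersecting over the fibres of `e` avoids choosing an inverse; by injectivity each
  -- intersection is a single `t j`.
  have : (fun (a : ι → S) (j : κ) => a (e j)) ⁻¹' (s : Set κ).pi t =
      (s.image e : Set ι).pi fun i => ⋂ j ∈ s, ⋂ (_ : e j = i), t j := by
    ext a
    simp only [Set.mem_preimage, Set.mem_pi, Finset.coe_image, Set.mem_iInter]
    constructor
    · rintro h _ ⟨j, hj, rfl⟩ j' hj' hjj'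
      rw [← hjj']
      exact h j' hj'
    · intro h j hj
      exact h (e j) ⟨j, hj, rfl⟩ j hj rfl
  rw [this, Measure.infinitePi_pi _ fun i _ => Finset.measurableSet_biInter _ fun j _ =>
    .iInter fun _ => ht j, Finset.prod_image he.injOn]
  refine Finset.prod_congr rfl fun j hj => ?_
  congr 1
  ext x
  simp only [Set.mem_iInter]
  exact ⟨fun h => h j hj rfl, fun h j' _ hj' => he hj' ▸ h⟩

open ProbabilityTheory in
lemma infinitePi_inter_eq_mul (I : Finset ι) {t : ι → Set S} (ht : ∀ i, MeasurableSet (t i))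
    {D : Set (ι → S)} (hD : MeasurableSet D)
    (hD' : ∀ x y : ι → S, (∀ i, i ∉ I → x i = y i) → x ∈ D → y ∈ D) :
    (Measure.infinitePi fun _ => μ) ((I : Set ι).pi t ∩ D) =
      (Measure.infinitePi fun _ => μ) ((I : Set ι).pi t) *
        (Measure.infinitePi fun _ => μ) D := by
  classical
  have hle : ∀ i : ι, MeasurableSpace.comap (fun x : ι → S => x i) inferInstance ≤
      (inferInstance : MeasurableSpace (ι → S)) := fun i => (measurable_pi_apply i).comap_le
  have hind : iIndepFun (fun (i : ι) (x : ι → S) => x i) (Measure.infinitePi fun _ : ι => μ) :=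
    iIndepFun_infinitePi (X := fun _ : ι => (id : S → S)) fun _ => measurable_id
  have h := indep_iSup_of_disjoint hle hind
    (S := (I : Set ι)) (T := (I : Set ι)ᶜ) disjoint_compl_right
  rw [Indep_iff] at h
  refine h _ _ ?_ ?_
  · rw [Set.pi_def]
    refine @Finset.measurableSet_biInter _ _ (_) _ _ fun i hi => ?_
    exact (le_iSup₂_of_le (f := fun (i : ι) (_ : i ∈ (I : Set ι)) =>
      MeasurableSpace.comap (fun x : ι → S => x i) inferInstance) i hi le_rfl) _ ⟨t i, ht i, rfl⟩
  · rcases D.eq_empty_or_nonempty with rfl | ⟨w, -⟩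
    · exact @MeasurableSet.empty _ (_)
    -- Freezing the coordinates in `I` at those of `w` leaves `D` unchanged, so `D` is measurable
    -- with respect to the other coordinates, which are independent of those in `I`.
    set φ : (ι → S) → ι → S := fun x i => if i ∈ I then w i else x i
    have hφ : D = φ ⁻¹' D := by
      ext x
      refine ⟨fun hx => hD' _ _ (fun i hi => ?_) hx, fun hx => hD' _ _ (fun i hi => ?_) hx⟩ <;>
      simp [φ, hi]
    rw [hφ]
    refine (@measurable_pi_lambda _ _ _ (_) _ φ fun i => ?_) hD
    by_cases hi : i ∈ I
    · simp only [φ, hi, if_true]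
      exact @measurable_const _ _ _ (_) _
    · simp only [φ, hi, if_false]
      refine Measurable.mono (comap_measurable _) (le_iSup₂_of_le (f := fun (i : ι)
        (_ : i ∈ (I : Set ι)ᶜ) => MeasurableSpace.comap (fun x : ι → S => x i) inferInstance)
        i (by simpa using hi) le_rfl) le_rfl

lemma prod_inter_preimage_snd {α β : Type*} [MeasurableSpace α] [MeasurableSpace β]
    {μ : Measure α} {ν : Measure β} [SFinite ν] {C : Set β} (hC : MeasurableSet C)
    {E : Set (α × β)} (hE : MeasurableSet E)
    (h : ∀ x, ν (C ∩ Prod.mk x ⁻¹' E) = ν C * ν (Prod.mk x ⁻¹' E)) :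
    μ.prod ν (Prod.snd ⁻¹' C ∩ E) = ν C * μ.prod ν E := by
  rw [Measure.prod_apply ((measurable_snd hC).inter hE), Measure.prod_apply hE,
    ← lintegral_const_mul _ (measurable_measure_prodMk_left hE)]
  exact lintegral_congr fun x => h x

lemma prod_inter_preimage_fst {α β : Type*} [MeasurableSpace α] [MeasurableSpace β]
    {μ : Measure α} {ν : Measure β} [SFinite μ] [SFinite ν] {C : Set α} (hC : MeasurableSet C)
    {E : Set (α × β)} (hE : MeasurableSet E)
    (h : ∀ y, μ (C ∩ (fun x => (x, y)) ⁻¹' E) = μ C * μ ((fun x => (x, y)) ⁻¹' E)) :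
    μ.prod ν (Prod.fst ⁻¹' C ∩ E) = μ C * μ.prod ν E := by
  rw [Measure.prod_apply_symm ((measurable_fst hC).inter hE), Measure.prod_apply_symm hE,
    ← lintegral_const_mul _ (measurable_measure_prodMk_right hE)]
  exact lintegral_congr fun x => h x

end InfinitePi

lemma uniformProduct_pi_singleton (k : ℕ) [NeZero k] (J : Finset ℤ) (w : ℤ → Fin k) :
    uniformProduct k ((J : Set ℤ).pi fun i => {w i}) = (k : ℝ≥0∞)⁻¹ ^ J.card := by
  rw [uniformProduct, Measure.infinitePi_pi _ fun i _ => measurableSet_singleton _]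
  simp

/-- Being constant along infinitely many coordinates, with a given value, is a null event. -/
lemma uniformProduct_forall_eq_const (k : ℕ) [NeZero k] (hk : k ≠ 1) {e : ℕ → ℤ}
    (he : Function.Injective e) (j : Fin k) :
    uniformProduct k {b | ∀ n, b (e n) = j} = 0 := by
  classical
  have hk1 : 1 < k := by have := NeZero.ne k; omega
  have h : ∀ n : ℕ, uniformProduct k {b | ∀ n, b (e n) = j} ≤ (k : ℝ≥0∞)⁻¹ ^ n := fun n => by
    have := uniformProduct_pi_singleton k ((Finset.range n).image e) fun _ => j
    rw [Finset.card_image_of_injective _ he, Finset.card_range] at this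
    rw [← this]
    refine measure_mono fun b hb i hi => ?_
    obtain ⟨i, -, rfl⟩ := by simpa using hi
    exact hb i
  refine le_antisymm (ge_of_tendsto' (ENNReal.tendsto_pow_atTop_nhds_zero_of_lt_one ?_) h) zero_le
  exact ENNReal.inv_lt_one.2 (by exact_mod_cast hk1)

/-! ### The bracket measure in terms of types carried by positions -/

variable {m : ℕ}

lemma oneIndex_lt_of_lt {z : ℤ → Fin 2} {k k' : ℤ} (hk : z k = 1) (hk' : z k' = 1) (h : k < k') :
    oneIndex z k < oneIndex z k' := by
  have h0 : ∀ i : ℤ, 0 ≤ ((z i : ℕ) : ℤ) := fun i => by omega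
  unfold oneIndex
  rcases le_or_gt 0 k with h1 | h1
  · rw [if_pos h1, if_pos (by omega)]
    exact Finset.sum_lt_sum_of_subset (Finset.Icc_subset_Icc le_rfl h.le)
      (i := k') (by simp; omega) (by simp; omega) (by simp [hk']) fun j _ _ => h0 j
  · rw [if_neg (by omega)]
    have hneg : 0 < ∑ i ∈ Finset.Icc k (-1), ((z i : ℕ) : ℤ) :=
      Finset.sum_pos' (fun i _ => h0 i) ⟨k, by simp; omega, by simp [hk]⟩
    split_ifs with h2
    · have : 0 ≤ ∑ i ∈ Finset.Icc 0 k', ((z i : ℕ) : ℤ) := Finset.sum_nonneg fun i _ => h0 i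
      omega
    · rw [neg_lt_neg_iff]
      exact Finset.sum_lt_sum_of_subset (Finset.Icc_subset_Icc h.le le_rfl)
        (i := k) (by simp; omega) (by simp; omega) (by simp [hk]) fun j _ _ => h0 j

lemma oneIndex_injOn (z : ℤ → Fin 2) :
    Function.Injective fun n : {n // z n = 1} => oneIndex z n := by
  rintro ⟨k, hk⟩ ⟨k', hk'⟩ h
  rcases lt_trichotomy k k' with h1 | rfl | h1
  · exact absurd h (oneIndex_lt_of_lt hk hk' h1).ne
  · rfl
  · exact absurd h (oneIndex_lt_of_lt hk' hk h1).ne'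

lemma measurable_typing (z : ℤ → Fin 2) : Measurable (typing (m := m) z) := by
  refine measurable_pi_lambda _ fun n => ?_
  unfold typing
  split_ifs
  · exact (measurable_of_countable Letter.α).comp (measurable_pi_apply _)
  · exact (measurable_of_countable Letter.β).comp (measurable_pi_apply _)

/-- A measurable map that agrees with `typing` over the recurrent set. -/
def measurableTyping (p : (ℤ → Fin 2) × (ℤ → Fin m)) : ℤ → Letter m := fun n =>
  if p.1 n = 1 then Letter.α (p.2 n)
  else Letter.β (p.2 (recurrentSet.indicator (fun z => matchIndex z n) p.1))

lemma measurableTyping_eq {p : (ℤ → Fin 2) × (ℤ → Fin m)} (h : p.1 ∈ recurrentSet) :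
    measurableTyping p = typing p.1 p.2 := by
  funext n
  rw [measurableTyping, Set.indicator_of_mem h, typing]

lemma measurable_measurableTyping : Measurable (measurableTyping (m := m)) := by
  refine measurable_pi_lambda _ fun n => Measurable.ite ?_ ?_ ?_
  · exact (measurable_pi_apply n).comp measurable_fst (measurableSet_singleton 1)
  · exact (measurable_of_countable Letter.α).comp ((measurable_pi_apply _).comp measurable_snd)
  · exact (measurable_of_countable Letter.β).comp (measurable_eval_index measurable_snd
      ((measurable_indicator_matchIndex n).comp measurable_fst))

lemma measurableSet_typing_mem {B : Set (ℤ → Letter m)} (hB : MeasurableSet B) :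
    MeasurableSet {p : (ℤ → Fin 2) × (ℤ → Fin m) | p.1 ∈ recurrentSet ∧ typing p.1 p.2 ∈ B} := by
  have : {p : (ℤ → Fin 2) × (ℤ → Fin m) | p.1 ∈ recurrentSet ∧ typing p.1 p.2 ∈ B} =
      Prod.fst ⁻¹' recurrentSet ∩ measurableTyping ⁻¹' B := by
    ext p
    refine and_congr_right fun h => ?_
    rw [Set.mem_preimage, measurableTyping_eq h]
  rw [this]
  exact (measurable_fst measurableSet_recurrentSet).inter (measurable_measurableTyping hB)

/-- Numbering the types by `oneIndex` instead of by position. -/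
def renumber (p : (ℤ → Fin 2) × (ℤ → Fin m)) : (ℤ → Fin 2) × (ℤ → Fin m) :=
  (p.1, fun n => p.2 (oneIndex p.1 n))

lemma measurable_renumber : Measurable (renumber (m := m)) :=
  measurable_fst.prodMk (measurable_pi_lambda _ fun n =>
    measurable_eval_index measurable_snd ((measurable_oneIndex n).comp measurable_fst))

lemma measurableSet_block_eq (r : ℤ) (n : ℕ) (l : List (Letter m)) :
    MeasurableSet {x : ℤ → Letter m | block x r n = l} := by
  have : {x : ℤ → Letter m | block x r n = l} =
      (fun (x : ℤ → Letter m) (i : Fin n) => x (r + (i : ℕ))) ⁻¹' {f | List.ofFn f = l} := rfl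
  rw [this]
  exact (measurable_pi_lambda _ fun i => measurable_pi_apply _) (Set.to_countable _).measurableSet

lemma measurableSet_dyckShift : MeasurableSet (dyckShift m) := by
  have : dyckShift m = ⋂ (r : ℤ) (n : ℕ) (l : List (Letter m)) (_ : l ∉ dyckLanguage m),
      {x | block x r n = l}ᶜ := by
    ext x
    simp only [dyckShift, Set.mem_iInter, Set.mem_compl_iff]
    exact ⟨fun h r n l hl hx => hl (hx ▸ h r n), fun h r n => by
      by_contra hc
      exact h r n _ hc rfl⟩
  rw [this]
  exact .iInter fun r => .iInter fun n => .iInter fun l => .iInter fun _ =>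
    (measurableSet_block_eq r n l).compl

variable [NeZero m]

/-- Only the types at ones are read, and both numberings are injective there, so they induce the
same product law on those types. -/
lemma uniformProduct_typing_oneIndex {z : ℤ → Fin 2} (hz : z ∈ recurrentSet)
    {B : Set (ℤ → Letter m)} (hB : MeasurableSet B) :
    uniformProduct m {a | typing z (fun n => a (oneIndex z n)) ∈ B} =
      uniformProduct m {b | typing z b ∈ B} := by
  -- The default 0 sits at closing brackets, where no type is read.
  set extend : ({n // z n = 1} → Fin m) → ℤ → Fin m := fun f n =>
    if h : z n = 1 then f ⟨n, h⟩ else 0 with hext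
  have hextend : Measurable extend := by
    refine measurable_pi_lambda _ fun n => ?_
    simp only [hext]
    split_ifs
    · exact measurable_pi_apply _
    · exact measurable_const
  have hD : MeasurableSet ((fun f => typing z (extend f)) ⁻¹' B) :=
    (measurable_typing z).comp hextend hB
  have key : ∀ e : ℤ → ℤ, (Function.Injective fun n : {n // z n = 1} => e n) →
      uniformProduct m {a | typing z (fun n => a (e n)) ∈ B} =
      Measure.infinitePi (fun _ : {n // z n = 1} => (PMF.uniformOfFintype (Fin m)).toMeasure)
        ((fun f => typing z (extend f)) ⁻¹' B) := fun e he => by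
    rw [← infinitePi_map_comp _ he, Measure.map_apply
      (f := fun (a : ℤ → Fin m) (n : {n // z n = 1}) => a (e n)) (measurable_pi_lambda _ fun j => measurable_pi_apply _) hD]
    have hcongr : ∀ a : ℤ → Fin m, typing z (fun n => a (e n)) =
        typing z (extend fun n => a (e n)) := fun a =>
      typing_congr hz fun n hn => by simp [hext, hn]
    simp only [hcongr]
    rfl
  rw [key _ (oneIndex_injOn z), key (fun n => n) Subtype.val_injective]

theorem bracketMeasure_apply {B : Set (ℤ → Letter m)} (hB : MeasurableSet B) :
    bracketMeasure m B = (uniformProduct 2).prod (uniformProduct m)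
      {p | p.1 ∈ recurrentSet ∧ typing p.1 p.2 ∈ B} := by
  have hS : MeasurableSet (recurrentSet ×ˢ (Set.univ : Set (ℤ → Fin m))) :=
    measurableSet_recurrentSet.prod .univ
  have hF : AEMeasurable (bracketTyping m)
      (((uniformProduct 2).prod (uniformProduct m)).restrict (recurrentSet ×ˢ Set.univ)) := by
    refine ⟨measurableTyping ∘ renumber, measurable_measurableTyping.comp measurable_renumber, ?_⟩
    filter_upwards [ae_restrict_mem hS] with p hp
    exact (measurableTyping_eq (p := renumber p) hp.1).symm
  have hE := measurableSet_typing_mem hB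
  rw [bracketMeasure, Measure.map_apply_of_aemeasurable hF hB, Measure.restrict_apply' hS]
  have hset : bracketTyping m ⁻¹' B ∩ recurrentSet ×ˢ Set.univ =
      renumber ⁻¹' {p | p.1 ∈ recurrentSet ∧ typing p.1 p.2 ∈ B} := by
    ext ⟨z, a⟩
    constructor
    · rintro ⟨h1, h2, -⟩
      exact ⟨h2, h1⟩
    · rintro ⟨h1, h2⟩
      exact ⟨h2, h1, trivial⟩
  rw [hset, Measure.prod_apply (measurable_renumber hE), Measure.prod_apply hE]
  refine lintegral_congr fun z => ?_
  by_cases hz : z ∈ recurrentSet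
  · simpa [renumber, hz, Set.preimage] using uniformProduct_typing_oneIndex hz hB
  · simp [renumber, hz, Set.preimage]

lemma ae_fst_mem_recurrentSet :
    ∀ᵐ p ∂(uniformProduct 2).prod (uniformProduct m), p.1 ∈ recurrentSet :=
  Measure.quasiMeasurePreserving_fst.ae ae_mem_recurrentSet

instance : IsProbabilityMeasure (bracketMeasure m) := by
  refine ⟨?_⟩
  rw [bracketMeasure_apply .univ, ← measure_univ (μ := (uniformProduct 2).prod (uniformProduct m))]
  refine measure_congr ?_
  filter_upwards [ae_fst_mem_recurrentSet] with p hp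
  exact eq_true ⟨hp, trivial⟩

theorem bracketMeasure_compl_dyckShift : bracketMeasure m (dyckShift m)ᶜ = 0 := by
  rw [bracketMeasure_apply measurableSet_dyckShift.compl]
  convert measure_empty (μ := (uniformProduct 2).prod (uniformProduct m))
  ext p
  simp only [Set.mem_empty_iff_false, iff_false]
  exact fun h => h.2 (typing_mem_dyckShift h.1 _)

end

section

/-! ### Replacing a block -/

/-- The sequence that equals `u` on `[-N, N]` and `x` elsewhere. -/
def splice {S : Type*} (N : ℕ) (u x : ℤ → S) : ℤ → S := fun i => if |i| ≤ N then u i else x i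

lemma splice_of_le {S : Type*} {N : ℕ} {u x : ℤ → S} {i : ℤ} (h : |i| ≤ N) :
    splice N u x i = u i := if_pos h

lemma splice_of_lt {S : Type*} {N : ℕ} {u x : ℤ → S} {i : ℤ} (h : (N : ℤ) < |i|) :
    splice N u x i = x i := if_neg (not_le.2 h)

lemma measurable_splice {S : Type*} [MeasurableSpace S] (N : ℕ) (u : ℤ → S) :
    Measurable (splice N u) := by
  refine measurable_pi_lambda _ fun i => ?_
  unfold splice
  split_ifs
  · exact measurable_const
  · exact measurable_pi_apply i

lemma height_add_natCast (z : ℤ → Fin 2) (a : ℤ) (n : ℕ) :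
    height z (a + n) = height z a + (2 * ((Finset.Ico a (a + n)).filter fun i => z i = 1).card - n)
    := by
  induction n with
  | zero => simp
  | succ n ih =>
    have h : Finset.Ico a (a + (n + 1 : ℕ)) = insert (a + n) (Finset.Ico a (a + n)) := by
      ext; simp; omega
    rw [h, Finset.filter_insert]
    push_cast
    rw [← add_assoc, height_add_one, ih]
    split_ifs
    · rw [Finset.card_insert_of_notMem (by simp)]
      push_cast; ring
    · ring

lemma height_eq_add_of_le {z z' : ℤ → Fin 2} {a : ℤ} (h : ∀ i < a, z i = z' i) {i : ℤ}
    (hi : i ≤ a) : height z' i = height z i + (height z' a - height z a) := by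
  induction i, hi using Int.leInductionDown with
  | base => ring
  | pred i hi ih =>
    have h1 := height_add_one z (i - 1)
    have h2 := height_add_one z' (i - 1)
    rw [h _ (by omega)] at h1
    rw [sub_add_cancel] at h1 h2
    omega

lemma height_eq_add_of_ge {z z' : ℤ → Fin 2} {a : ℤ} (h : ∀ i, a ≤ i → z i = z' i) {i : ℤ}
    (hi : a ≤ i) : height z' i = height z i + (height z' a - height z a) := by
  induction i, hi using Int.leInduction with
  | base => ring
  | succ i hi ih => rw [height_add_one, height_add_one, ih, h i hi]; ring

lemma mem_recurrentSet_of_eq {z z' : ℤ → Fin 2} {N : ℕ} (h : ∀ i, (N : ℤ) < |i| → z i = z' i)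
    (hz : z ∈ recurrentSet) : z' ∈ recurrentSet := by
  have hl := fun i => height_eq_add_of_le (z := z) (z' := z') (a := -N)
    (fun i hi => h i (by rw [abs_of_neg (by omega)]; omega)) (i := i)
  have hr := fun i => height_eq_add_of_ge (z := z) (z' := z') (a := N + 1)
    (fun i hi => h i (by rw [abs_of_pos (by omega)]; omega)) (i := i)
  rw [mem_recurrentSet_iff] at hz ⊢
  refine ⟨fun c M => ?_, fun c M => ?_⟩
  · obtain ⟨n, hn, hn'⟩ := hz.1 (c - (height z' (N + 1) - height z (N + 1))) (max M (N + 1))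
    have := hr n (by omega)
    exact ⟨n, by omega, by omega⟩
  · obtain ⟨n, hn, hn'⟩ := hz.2 (c - (height z' (-N) - height z (-N))) (min M (-N))
    have := hl n (by omega)
    exact ⟨n, by omega, by omega⟩

/-- If two recurrent patterns agree off `[-N, N]` but have different numbers of ones there, then
far-away closing brackets have matches at different levels to the left of the block. -/
lemma exists_matchIndex_eq {z z' : ℤ → Fin 2} {N : ℕ} (h : ∀ i, (N : ℤ) < |i| → z i = z' i)
    (hz : z ∈ recurrentSet)
    (hcard : ((Finset.Icc (-N : ℤ) N).filter fun i => z i = 1).card ≠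
      ((Finset.Icc (-N : ℤ) N).filter fun i => z' i = 1).card) :
    ∃ d h₀ : ℤ, d ≠ 0 ∧ h₀ < height z (-N) ∧ ∀ k ≤ h₀, k + d < height z (-N) ∧
      ∃ n : ℤ, N < n ∧ z n ≠ 1 ∧
        matchIndex z n = lastBelow z (-N) k ∧ matchIndex z' n = lastBelow z (-N) (k + d) := by
  have hl := fun i => height_eq_add_of_le (z := z) (z' := z') (a := -N)
    (fun i hi => h i (by rw [abs_of_neg (by omega)]; omega)) (i := i)
  have hr := fun i => height_eq_add_of_ge (z := z) (z' := z') (a := N + 1)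
    (fun i hi => h i (by rw [abs_of_pos (by omega)]; omega)) (i := i)
  have hI : Finset.Icc (-N : ℤ) N = Finset.Ico (-N : ℤ) (-N + (2 * N + 1 : ℕ)) := by
    ext; simp; omega
  have hN : (-N : ℤ) + (2 * N + 1 : ℕ) = N + 1 := by push_cast; ring
  have h1 := height_add_natCast z (-N) (2 * N + 1)
  have h2 := height_add_natCast z' (-N) (2 * N + 1)
  rw [← hI, hN] at h1 h2
  set cL := height z' (-N) - height z (-N) with hcL
  set cR := height z' (N + 1) - height z (N + 1) with hcR
  have hbd : ∀ (w : ℤ → Fin 2) (i : ℤ), -N ≤ i → i ≤ N + 1 → -(N + 1 : ℤ) ≤ height w i :=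
    fun w i hi hi' => by
      have := neg_abs_le_height w i
      have : |i| ≤ N + 1 := abs_le.2 ⟨by omega, hi'⟩
      omega
  have habsL := abs_nonneg cL
  have habsR := abs_nonneg cR
  have hleL := neg_abs_le cL
  have hleR := le_abs_self cR
  -- Heights are anchored at 0, inside the block, so the patterns may be offset on both sides; `cR -
  -- cL` is twice the difference in the number of ones. The bound on levels lies below every height
  -- of either pattern over the block, with room for both offsets.
  refine ⟨cR - cL, -(N + 2) - |cR| - |cL|, by omega, ?_, fun k hk => ⟨?_, ?_⟩⟩
  · have := hbd z (-N) (by omega) (by omega)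
    omega
  · have := hbd z (-N) (by omega) (by omega)
    omega
  -- The first descent to level `k` right of the block ends with a closing bracket, whose match must
  -- lie left of the block.
  obtain ⟨p, ⟨hp1, hp2⟩, hp⟩ := Int.exists_least_of_bdd
    (P := fun p => (N : ℤ) + 1 ≤ p ∧ height z p ≤ k) ⟨N + 1, fun p hp => hp.1⟩ (by
      obtain ⟨p, hp, hp'⟩ := (mem_recurrentSet_iff.1 hz).1 k (N + 1)
      exact ⟨p, by omega, by omega⟩)
  have hp3 : p ≠ N + 1 := by
    rintro rfl
    have := hbd z (N + 1) (by omega) (by omega)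
    omega
  have hmin : ∀ i : ℤ, N + 1 ≤ i → i < p → k < height z i := fun i hi hip => by
    by_contra! hc
    have := hp i ⟨hi, hc⟩
    omega
  obtain ⟨n, rfl⟩ : ∃ n, p = n + 1 := ⟨p - 1, by ring⟩
  have hn := hmin n (by omega) (by omega)
  have hz1 : z n ≠ 1 := fun h1 => by
    have := height_add_one_of_one h1
    omega
  have hk' : height z (n + 1) = k := by
    have := height_add_one_of_ne hz1
    omega
  refine ⟨n, by omega, hz1, ?_, ?_⟩
  · obtain ⟨s1, s2, s3⟩ := lastBelow_spec hz (-N) k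
    rw [matchIndex_eq, hk']
    refine lastBelow_eq (by omega) s2 fun i hi hi' => ?_
    rcases lt_or_ge i (-N) with hiN | hiN
    · exact s3 i hi hiN
    rcases le_or_gt i (N + 1) with hiN' | hiN'
    · have := hbd z i hiN hiN'
      omega
    · exact hmin i hiN'.le (by omega)
  -- For `z'` this bracket ends at level `k + cR`, which left of the block is level `k + cR - cL` of
  -- `z`.
  · obtain ⟨s1, s2, s3⟩ := lastBelow_spec hz (-N) (k + (cR - cL))
    rw [matchIndex_eq, hr _ hp1, hk']
    refine lastBelow_eq (by omega) (by rw [hl _ s1.le]; omega) fun i hi hi' => ?_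
    rcases lt_or_ge i (-N) with hiN | hiN
    · rw [hl _ hiN.le]
      have := s3 i hi hiN
      omega
    rcases le_or_gt i (N + 1) with hiN' | hiN'
    · have := hbd z' i hiN hiN'
      omega
    · rw [hr _ hiN'.le]
      have := hmin i hiN'.le (by omega)
      omega

variable {m : ℕ} [NeZero m]

/-- The equalities chain levels `|d|` apart, forcing one common type at infinitely many positions.
-/
lemma uniformProduct_matchIndex_eq_zero (hm : m ≠ 1) {z z' : ℤ → Fin 2} {N : ℕ}
    (h : ∀ i, (N : ℤ) < |i| → z i = z' i) (hz : z ∈ recurrentSet)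
    (hcard : ((Finset.Icc (-N : ℤ) N).filter fun i => z i = 1).card ≠
      ((Finset.Icc (-N : ℤ) N).filter fun i => z' i = 1).card) :
    uniformProduct m {b | ∀ n : ℤ, N < n → z n ≠ 1 → matchIndex z n < -N →
      matchIndex z' n < -N → b (matchIndex z n) = b (matchIndex z' n)} = 0 := by
  obtain ⟨d, h₀, hd, hh₀, H⟩ := exists_matchIndex_eq h hz hcard
  set e : ℕ → ℤ := fun j => lastBelow z (-N) (h₀ - j * |d|) with he
  have hdpos : 0 < |d| := abs_pos.2 hd
  have hlevel : ∀ j : ℕ, h₀ - j * |d| ≤ h₀ := fun j => by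
    have : 0 ≤ (j : ℤ) * |d| := by positivity
    omega
  have hinj : Function.Injective e := fun i j hij => by
    have hi := (lastBelow_spec_of_lt hz ((hlevel i).trans_lt hh₀)).1
    have hj := (lastBelow_spec_of_lt hz ((hlevel j).trans_lt hh₀)).1
    simp only [he] at hij
    rw [hij, hj] at hi
    have : (j : ℤ) * |d| = i * |d| := by omega
    exact_mod_cast (mul_right_cancel₀ hdpos.ne' this).symm
  refine measure_mono_null (t := ⋃ j : Fin m, {b | ∀ n, b (e n) = j}) (fun b hb => ?_)
    (measure_iUnion_null fun j => uniformProduct_forall_eq_const m hm hinj j)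
  have hstep : ∀ k ≤ h₀, b (lastBelow z (-N) k) = b (lastBelow z (-N) (k + d)) := fun k hk => by
    obtain ⟨-, n, hn, hzn, h1, h2⟩ := H k hk
    rw [← h1, ← h2]
    exact hb n hn hzn (h1 ▸ (lastBelow_spec hz _ _).1) (h2 ▸ (lastBelow_spec hz _ _).1)
  rw [Set.mem_iUnion]
  refine ⟨b (e 0), fun n => ?_⟩
  induction n with
  | zero => rfl
  | succ n ih =>
    rw [← ih]
    have h1 := hlevel n
    have h2 := hlevel (n + 1)
    have h3 : h₀ - ((n + 1 : ℕ) : ℤ) * |d| = h₀ - n * |d| - |d| := by push_cast; ring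
    simp only [he]
    -- The sign of `d` decides from which of the two neighbouring levels the relation is applied.
    rcases abs_cases d with ⟨hd', -⟩ | ⟨hd', -⟩
    · rw [hstep _ h2]
      congr 2
      omega
    · rw [hstep _ h1]
      congr 2
      omega

end

/-! ### Exchanging blocks, and invariance under holonomies -/

section

open scoped ENNReal

variable {m : ℕ}

/-- The pairs of a pattern and types which, after the block `u` is put in place, give a point
of `B`. -/
def spliceSet (N : ℕ) (u : ℤ → Letter m) (B : Set (ℤ → Letter m)) :
    Set ((ℤ → Fin 2) × (ℤ → Fin m)) :=
  {p | splice N (fun i => (u i).dir) p.1 ∈ recurrentSet ∧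
    typing (splice N (fun i => (u i).dir) p.1) (splice N (fun i => (u i).type) p.2) ∈ B}

/-- The positions of the opening brackets in the block `u`. -/
def opens (N : ℕ) (u : ℤ → Letter m) : Finset ℤ :=
  (Finset.Icc (-N : ℤ) N).filter fun i => (u i).dir = 1

variable {N : ℕ} {u v : ℤ → Letter m} {B B' : Set (ℤ → Letter m)}

lemma measurableSet_spliceSet (hB : MeasurableSet B) : MeasurableSet (spliceSet N u B) :=
  (((measurable_splice N _).comp measurable_fst).prodMk
    ((measurable_splice N _).comp measurable_snd)) (measurableSet_typing_mem hB)


/-- This separates the block from its surroundings: `spliceSet` ignores all coordinates in `[-N,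
N]`. Types at closing positions of the block are left free because they are never read. -/
lemma typing_mem_eq_inter (hB : ∀ x ∈ B, ∀ i : ℤ, |i| ≤ N → x i = u i) :
    {p : (ℤ → Fin 2) × (ℤ → Fin m) | p.1 ∈ recurrentSet ∧ typing p.1 p.2 ∈ B} =
      Prod.fst ⁻¹' ((Finset.Icc (-N : ℤ) N : Set ℤ).pi fun i => {(u i).dir}) ∩
        (Prod.snd ⁻¹' ((opens N u : Set ℤ).pi fun i => {(u i).type}) ∩ spliceSet N u B) := by
  ext ⟨z, b⟩
  have hdir : (∀ i : ℤ, |i| ≤ N → z i = (u i).dir) → splice N (fun i => (u i).dir) z = z :=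
    fun h => funext fun i => by
      by_cases hi : |i| ≤ N
      · rw [splice_of_le hi, h i hi]
      · rw [splice_of_lt (not_le.1 hi)]
  have htype : z ∈ recurrentSet → (∀ i : ℤ, |i| ≤ N → z i = 1 → b i = (u i).type) →
      typing z (splice N (fun i => (u i).type) b) = typing z b := fun hz h =>
    typing_congr hz fun i hzi => by
      by_cases hi : |i| ≤ N
      · rw [splice_of_le hi, h i hi hzi]
      · rw [splice_of_lt (not_le.1 hi)]
  constructor
  · rintro ⟨hz, hzb⟩
    change z ∈ recurrentSet at hz
    change typing z b ∈ B at hzb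
    have h1 : ∀ i : ℤ, |i| ≤ N → z i = (u i).dir := fun i hi => by
      rw [← hB _ hzb i hi, dir_typing]
    have h2 : ∀ i : ℤ, |i| ≤ N → z i = 1 → b i = (u i).type := fun i hi hzi => by
      rw [← hB _ hzb i hi, type_typing hzi]
    refine ⟨fun i hi => h1 i (abs_le.2 (by simpa using hi)), fun i hi => ?_, ?_⟩
    · obtain ⟨hi, hui⟩ := Finset.mem_filter.1 hi
      have hi : |i| ≤ N := abs_le.2 (by simpa using hi)
      exact h2 i hi ((h1 i hi).trans hui)
    · change splice N (fun i => (u i).dir) z ∈ recurrentSet ∧ typing _ _ ∈ B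
      rw [hdir h1, htype hz h2]
      exact ⟨hz, hzb⟩
  · rintro ⟨h1, h2, hz, hzb⟩
    have h1 : ∀ i : ℤ, |i| ≤ N → z i = (u i).dir := fun i hi =>
      h1 i (by simpa using abs_le.1 hi)
    have h2 : ∀ i : ℤ, |i| ≤ N → z i = 1 → b i = (u i).type := fun i hi hzi =>
      h2 i (Finset.mem_filter.2 ⟨by simpa using abs_le.1 hi, (h1 i hi) ▸ hzi⟩)
    change splice N (fun i => (u i).dir) z ∈ recurrentSet at hz
    change typing (splice N (fun i => (u i).dir) z) _ ∈ B at hzb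
    rw [hdir h1] at hz hzb
    rw [htype hz h2] at hzb
    exact ⟨hz, hzb⟩

lemma splice_congr {S : Type*} {w x y : ℤ → S} (h : ∀ i : ℤ, (N : ℤ) < |i| → x i = y i) :
    splice N w x = splice N w y := funext fun i => by
  by_cases hi : |i| ≤ N
  · rw [splice_of_le hi, splice_of_le hi]
  · rw [splice_of_lt (not_le.1 hi), splice_of_lt (not_le.1 hi), h i (not_le.1 hi)]

/-- Changing the block can rematch brackets outside it. Membership in the Dyck shift ensures that
the unchanged outer letters fit the new matching, through `typing_dir_type`. -/
lemma splice_typing {z : ℤ → Fin 2} {b : ℤ → Fin m}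
    (hz : splice N (fun i => (u i).dir) z ∈ recurrentSet)
    (hx : splice N v (typing (splice N (fun i => (u i).dir) z)
      (splice N (fun i => (u i).type) b)) ∈ dyckShift m) :
    splice N (fun i => (v i).dir) z ∈ recurrentSet ∧
      splice N v (typing (splice N (fun i => (u i).dir) z) (splice N (fun i => (u i).type) b)) =
        typing (splice N (fun i => (v i).dir) z) (splice N (fun i => (v i).type) b) := by
  have hv : splice N (fun i => (v i).dir) z ∈ recurrentSet :=
    mem_recurrentSet_of_eq (fun i hi => by rw [splice_of_lt hi, splice_of_lt hi]) hz
  refine ⟨hv, ?_⟩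
  set x := typing (splice N (fun i => (u i).dir) z) (splice N (fun i => (u i).type) b) with hxdef
  have hdir : (fun i => (splice N v x i).dir) = splice N (fun i => (v i).dir) z :=
    funext fun i => by
      by_cases hi : |i| ≤ N
      · rw [splice_of_le hi, splice_of_le hi]
      · rw [splice_of_lt (not_le.1 hi), splice_of_lt (not_le.1 hi), hxdef, dir_typing,
          splice_of_lt (not_le.1 hi)]
  rw [← typing_dir_type hx (hdir ▸ hv), hdir]
  refine typing_congr hv fun i hi1 => ?_
  by_cases hi : |i| ≤ N
  · rw [splice_of_le hi, splice_of_le hi]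
  · rw [splice_of_lt (not_le.1 hi)] at hi1
    rw [splice_of_lt (not_le.1 hi), splice_of_lt (not_le.1 hi), hxdef,
      type_typing (by rw [splice_of_lt (not_le.1 hi), hi1]), splice_of_lt (not_le.1 hi)]

lemma spliceSet_subset (h : ∀ x ∈ B, splice N v x ∈ B' ∧ splice N v x ∈ dyckShift m) :
    spliceSet N u B ⊆ spliceSet N v B' := by
  rintro ⟨z, b⟩ ⟨hz, hzb⟩
  obtain ⟨h1, h2⟩ := splice_typing (v := v) hz (h _ hzb).2
  refine ⟨h1, ?_⟩
  change typing (splice N (fun i => (v i).dir) z) _ ∈ B'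
  rw [← h2]
  exact (h _ hzb).1

variable [NeZero m]

lemma prod_pi_inter_spliceSet (hB : MeasurableSet B) :
    (uniformProduct 2).prod (uniformProduct m)
      (Prod.fst ⁻¹' ((Finset.Icc (-N : ℤ) N : Set ℤ).pi fun i => {(u i).dir}) ∩
        (Prod.snd ⁻¹' ((opens N u : Set ℤ).pi fun i => {(u i).type}) ∩ spliceSet N u B)) =
      (2 : ℝ≥0∞)⁻¹ ^ (2 * N + 1) * ((m : ℝ≥0∞)⁻¹ ^ (opens N u).card *
        (uniformProduct 2).prod (uniformProduct m) (spliceSet N u B)) := by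
  have hE := measurableSet_spliceSet (N := N) (u := u) hB
  have hC : ∀ {k : ℕ} (J : Finset ℤ) (w : ℤ → Fin k),
      MeasurableSet ((J : Set ℤ).pi fun i => ({w i} : Set (Fin k))) := fun J w =>
    .pi J.countable_toSet fun i _ => measurableSet_singleton _
  rw [prod_inter_preimage_fst (hC _ _) ((measurable_snd (hC _ _)).inter hE),
    prod_inter_preimage_snd (hC _ _) hE, uniformProduct_pi_singleton,
    uniformProduct_pi_singleton]
  · congr 2
    rw [Int.card_Icc]
    omega
  · intro z
    refine infinitePi_inter_eq_mul _ _ (fun i => measurableSet_singleton _)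
      (measurable_prodMk_left hE) fun x y hxy hx => ?_
    have h : splice N (fun i => (u i).type) x = splice N (fun i => (u i).type) y :=
      splice_congr fun i hi => hxy i fun hi' => by
        rw [opens, Finset.mem_filter, Finset.mem_Icc, ← abs_le] at hi'
        exact not_le.2 hi hi'.1
    rw [Set.mem_preimage, spliceSet, Set.mem_ofPred_eq] at hx ⊢
    rwa [← h]
  · intro b
    refine infinitePi_inter_eq_mul _ _ (fun i => measurableSet_singleton _)
      (measurable_prodMk_right ((measurable_snd (hC _ _)).inter hE)) fun x y hxy hx => ?_
    have h : splice N (fun i => (u i).dir) x = splice N (fun i => (u i).dir) y :=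
      splice_congr fun i hi => hxy i (by
        rw [Finset.mem_Icc, ← abs_le]
        exact not_le.2 hi)
    refine ⟨hx.1, ?_⟩
    have hx2 := hx.2
    rw [spliceSet, Set.mem_ofPred_eq] at hx2 ⊢
    rwa [← h]

/-- Over each fixed pattern, a closing bracket right of the block keeps its letter. If its old and
new matches both lie left of the block, their types must agree. -/
lemma prod_spliceSet_eq_zero (hm : m ≠ 1) (hB : MeasurableSet B)
    (hBX : ∀ x ∈ B, splice N v x ∈ dyckShift m) (hcard : (opens N u).card ≠ (opens N v).card) :
    (uniformProduct 2).prod (uniformProduct m) (spliceSet N u B) = 0 := by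
  rw [Measure.measure_prod_null (measurableSet_spliceSet hB)]
  refine ae_of_all _ fun z => ?_
  by_cases hz : splice N (fun i => (u i).dir) z ∈ recurrentSet
  swap
  · simp [spliceSet, hz]
  have hones : ∀ w : ℤ → Letter m, opens N w = (Finset.Icc (-N : ℤ) N).filter
      fun i => splice N (fun i => (w i).dir) z i = 1 := fun w => by
    refine Finset.filter_congr fun i hi => ?_
    rw [splice_of_le (abs_le.2 (by simpa using hi))]
  rw [hones, hones] at hcard
  refine measure_mono_null (fun b hb => ?_) (uniformProduct_matchIndex_eq_zero (m := m) hm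
    (fun i hi => by rw [splice_of_lt hi, splice_of_lt hi]) hz hcard)
  obtain ⟨-, hb⟩ := hb
  intro n hn hzn h1 h2
  obtain ⟨-, h⟩ := splice_typing (v := v) hz (hBX _ hb)
  have hn' : (N : ℤ) < |n| := hn.trans_le (le_abs_self n)
  have hzn' := hzn
  rw [splice_of_lt hn'] at hzn'
  have habs : ∀ {i : ℤ}, i < -N → (N : ℤ) < |i| := fun hi => by
    rw [abs_of_neg (by omega)]; omega
  have hfun := congrFun h n
  rw [splice_of_lt hn', typing, if_neg hzn, typing, if_neg (by rwa [splice_of_lt hn']),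
    splice_of_lt (habs h1), splice_of_lt (habs h2)] at hfun
  exact Letter.β.inj hfun

/-- Replacing one block by another preserves the bracket measure on sets of points for which
both the old and the new sequence lie in the Dyck shift. -/
theorem bracketMeasure_eq_of_splice (hB : MeasurableSet B) (hB' : MeasurableSet B')
    (hBX : B ⊆ dyckShift m) (hBX' : B' ⊆ dyckShift m)
    (hBu : ∀ x ∈ B, ∀ i : ℤ, |i| ≤ N → x i = u i) (hBv : ∀ x ∈ B', ∀ i : ℤ, |i| ≤ N → x i = v i)
    (h : ∀ x ∈ B, splice N v x ∈ B') (h' : ∀ x ∈ B', splice N u x ∈ B) :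
    bracketMeasure m B = bracketMeasure m B' := by
  have hE : spliceSet N u B = spliceSet N v B' :=
    (spliceSet_subset fun x hx => ⟨h x hx, hBX' (h x hx)⟩).antisymm
      (spliceSet_subset fun x hx => ⟨h' x hx, hBX (h' x hx)⟩)
  rw [bracketMeasure_apply hB, bracketMeasure_apply hB', typing_mem_eq_inter hBu,
    typing_mem_eq_inter hBv, prod_pi_inter_spliceSet hB, prod_pi_inter_spliceSet hB', ← hE]
  -- With one type the factors `m^-k` all equal 1, so unequal numbers of opening brackets do no
  -- harm.
  by_cases hm : m = 1
  · simp [hm]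
  by_cases hcard : (opens N u).card = (opens N v).card
  · rw [hcard]
  · rw [prod_spliceSet_eq_zero hm hB (fun x hx => hBX' (h x hx)) hcard]
    simp

/-- The words on `[-N, N]`, as sequences that are constant elsewhere. -/
def extendWord (N : ℕ) (w : Finset.Icc (-N : ℤ) N → Letter m) : ℤ → Letter m := fun i =>
  if h : i ∈ Finset.Icc (-N : ℤ) N then w ⟨i, h⟩ else Letter.α 0

lemma extendWord_restrict (x : ℤ → Letter m) {i : ℤ} (hi : |i| ≤ N) :
    extendWord N (fun i => x i) i = x i := by
  rw [extendWord, dif_pos (by rw [Finset.mem_Icc]; exact abs_le.1 hi)]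

theorem isDoubleTailInvariant_bracketMeasure :
    IsDoubleTailInvariant (dyckShift m) (bracketMeasure m) := by
  intro A g hg
  have : StandardBorelSpace A := hg.measurableSet_dom.standardBorel
  -- Lusin–Souslin: an injective Borel map on a standard Borel space has measurable images.
  have hgE : MeasurableEmbedding g := hg.measurable.measurableEmbedding hg.injective
  have hvE : MeasurableEmbedding (Subtype.val : A → ℤ → Letter m) :=
    MeasurableEmbedding.subtype_coe hg.measurableSet_dom
  let s : (Σ N : ℕ, (Finset.Icc (-N : ℤ) N → Letter m) × (Finset.Icc (-N : ℤ) N → Letter m)) →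
      Set A := fun t => {x | (∀ i : ℤ, |i| ≤ t.1 → x.1 i = extendWord t.1 t.2.1 i) ∧
        (∀ i : ℤ, |i| ≤ t.1 → g x i = extendWord t.1 t.2.2 i) ∧
        ∀ i : ℤ, (t.1 : ℤ) < |i| → x.1 i = g x i}
  have hs : ⋃ t, s t = Set.univ := by
    refine Set.eq_univ_of_forall fun x => ?_
    obtain ⟨-, -, N, hN⟩ := hg.doubleTail x
    exact Set.mem_iUnion.2 ⟨⟨N, fun i => x.1 i, fun i => g x i⟩,
      fun i hi => (extendWord_restrict _ hi).symm, fun i hi => (extendWord_restrict _ hi).symm, hN⟩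
  have hsm : ∀ t, MeasurableSet (s t) := fun t => by
    have hx : ∀ i : ℤ, Measurable fun x : A => x.1 i := fun i =>
      (measurable_pi_apply i).comp measurable_subtype_coe
    have hgx : ∀ i : ℤ, Measurable fun x : A => g x i := fun i =>
      (measurable_pi_apply i).comp hg.measurable
    have h1 : ∀ {f f' : A → Letter m}, Measurable f → Measurable f' → ∀ p : Prop,
        MeasurableSet {x | p → f x = f' x} := fun hf hf' p => by
      by_cases hp : p
      · simpa [hp] using measurableSet_eq_fun hf hf'
      · simp [hp]
    have : s t = (⋂ i : ℤ, {x : A | |i| ≤ t.1 → x.1 i = extendWord t.1 t.2.1 i}) ∩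
        ((⋂ i : ℤ, {x : A | |i| ≤ t.1 → g x i = extendWord t.1 t.2.2 i}) ∩
        ⋂ i : ℤ, {x : A | (t.1 : ℤ) < |i| → x.1 i = g x i}) := by
      ext x
      simp only [s, Set.mem_inter_iff, Set.mem_iInter]
      rfl
    rw [this]
    exact (MeasurableSet.iInter fun i => h1 (hx i) measurable_const _).inter
      ((MeasurableSet.iInter fun i => h1 (hgx i) measurable_const _).inter
        (MeasurableSet.iInter fun i => h1 (hx i) (hgx i) _))
  -- The pieces overlap, as `N` need not be minimal. Comparing two measures on the domain makes
  -- agreement of their restrictions to a countable cover sufficient.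
  have key : (bracketMeasure m).comap Subtype.val = (bracketMeasure m).comap g := by
    refine Measure.ext_of_iUnion_eq_univ hs fun t => ?_
    ext C hC
    rw [Measure.restrict_apply hC, Measure.restrict_apply hC, hvE.comap_apply, hgE.comap_apply]
    have hCt := hC.inter (hsm t)
    have hspl : ∀ x ∈ s t, splice t.1 (extendWord t.1 t.2.2) x.1 = g x ∧
        splice t.1 (extendWord t.1 t.2.1) (g x) = x.1 := fun x hx => by
      constructor <;> funext i <;> by_cases hi : |i| ≤ t.1
      · rw [splice_of_le hi, hx.2.1 i hi]
      · rw [splice_of_lt (not_le.1 hi), hx.2.2 i (not_le.1 hi)]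
      · rw [splice_of_le hi, hx.1 i hi]
      · rw [splice_of_lt (not_le.1 hi), hx.2.2 i (not_le.1 hi)]
    refine bracketMeasure_eq_of_splice (N := t.1) (u := extendWord t.1 t.2.1)
      (v := extendWord t.1 t.2.2) (hvE.measurableSet_image' hCt) (hgE.measurableSet_image' hCt)
      ?_ ?_ ?_ ?_ ?_ ?_
    · rintro _ ⟨x, -, rfl⟩
      exact (hg.doubleTail x).1
    · rintro _ ⟨x, -, rfl⟩
      exact (hg.doubleTail x).2.1
    · rintro _ ⟨x, hx, rfl⟩
      exact hx.2.1
    · rintro _ ⟨x, hx, rfl⟩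
      exact hx.2.2.1
    · rintro _ ⟨x, hx, rfl⟩
      exact ⟨x, hx, (hspl x hx.2).1.symm⟩
    · rintro _ ⟨x, hx, rfl⟩
      exact ⟨x, hx, (hspl x hx.2).2.symm⟩
  have huniv := congrArg (fun μ => μ Set.univ) key
  simpa only [hvE.comap_apply, hgE.comap_apply, Set.image_univ, Subtype.range_coe] using huniv

end

end

end DyckShift

theorem mainTheorem3 (m : ℕ) [NeZero m] :
    IsProbabilityMeasure (DyckShift.bracketMeasure m) ∧
      DyckShift.bracketMeasure m (DyckShift.dyckShift m)ᶜ = 0 ∧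
      DyckShift.IsDoubleTailInvariant (DyckShift.dyckShift m) (DyckShift.bracketMeasure m) :=
  ⟨inferInstance, DyckShift.bracketMeasure_compl_dyckShift,
    DyckShift.isDoubleTailInvariant_bracketMeasure⟩
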